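/- Let $M,K\ge 1$ and let $n_{mk}\in\{0,1,2,\dots\}$ for $1\le m\le M$, $1\le k\le K$. Put $q=\max_{m,k}n_{mk}$ and let $S_q$ be the $q\times q$ down-shift matrix over $\mathbb F_2$ ($(S_q)_{ij}=1$ if $i=j+1$, and $0$ otherwise). In the $M$-transmitter $K$-receiver ADT (Avestimehr--Diggavi--Tse) multicast channel, at each time transmitter $m$ sends a vector $X_m\in\mathbb F_2^{q}$ and receiver $k$ observes $$Y_k=\sum_{m=1}^{M} S_q^{\,q-n_{mk}}X_m\in\mathbb F_2^{q}.$$ Transmitter $m$ has a message $W_m$; the messages are independent and $W_m$ is uniform on a set of $\lceil 2^{NR_m}\rceil$ elements, with $R_m\ge 0$. A feedback code of length $N$ consists of encoding functions $f_{mi}$, with $X_{mi}=f_{mi}(W_m,Y_1^{i-1},\dots,Y_K^{i-1})$ for $1\le i\le N$, and, for each receiver $k$, a decoding function that estimates all of $(W_1,\dots,W_M)$ from $Y_k^N$. A tuple $(R_1,\dots,R_M)$ of nonnegative reals is achievable if there are feedback codes, one for each length $N$, such that for every receiver the average probability that its estimate differs from $(W_1,\dots,W_M)$ tends to $0$ as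 $N\to\infty$. The feedback capacity region is the closure of the set of achievable tuples. Theorem. The feedback capacity region of the ADT multicast channel is exactly the set of $(R_1,\dots,R_M)$ with all $R_m\ge 0$ such that $$\sum_{m\in\mathcal S}R_m\le \operatorname{rank}(G_{\mathcal S})\quad\text{for all } \mathcal S\subsetneq\{1,\dots,M\},$$ $$\sum_{m=1}^{M}R_m\le\max\{n_{1k},\dots,n_{Mk}\}\quad\text{for all } k\in\{1,\dots,K\},$$ where $G_{\mathcal S}$ is the matrix over $\mathbb F_2$ with $Y=G_{\mathcal S}X_{\mathcal S}+G_{\mathcal S^c}X_{\mathcal S^c}$; here $Y$ is the stack of $Y_1,\dots,Y_K$, $X_{\mathcal S}$ is the stack of the $X_m$ with $m\in\mathcal S$, and the rank is over $\mathbb F_2$. -/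

import Mathlib

namespace ADTMulticast

/-! ### Feedback capacity of a deterministic memoryless multicast channel

A deterministic memoryless multicast channel with `M` transmitters and `K` receivers is a map
`ch : (Fin M → X) → Fin K → Y`: if transmitter `m` sends `x m`, then receiver `k` sees `ch x k`. -/

/-- A feedback code of length `N` with `L m` messages at transmitter `m`.
`enc m i` is the encoding function of transmitter `m` at time `i` (times start at `0`, and only
the times `i < N` matter): it maps the message of transmitter `m` and all outputs, at all `K`
receivers, of the times before `i` to the channel input. `dec k` is the decoding function of
receiver `k`: it maps the `N` outputs at receiver `k` to an estimate of all `M` messages. -/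
structure FeedbackCode (M K : ℕ) (X Y : Type*) (N : ℕ) (L : Fin M → ℕ) where
  enc : (m : Fin M) → (i : ℕ) → Fin (L m) → (Fin i → Fin K → Y) → X
  dec : Fin K → (Fin N → Y) → (m : Fin M) → Fin (L m)

namespace FeedbackCode

variable {M K : ℕ} {X Y : Type*} {N : ℕ} {L : Fin M → ℕ}

/-- The outputs at all receivers at time `i` when the messages are `w`. -/
def output (c : FeedbackCode M K X Y N L) (ch : (Fin M → X) → Fin K → Y)
    (w : (m : Fin M) → Fin (L m)) (i : ℕ) : Fin K → Y :=
  ch fun m => c.enc m i (w m) fun t : Fin i => output c ch w t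
termination_by i
decreasing_by exact t.isLt

/-- The average error probability at receiver `k`: the probability, for independent messages
`w m` uniform on `Fin (L m)`, that the estimate of receiver `k` is not the tuple `w`. -/
noncomputable def errorProb (c : FeedbackCode M K X Y N L) (ch : (Fin M → X) → Fin K → Y)
    (k : Fin K) : ℝ :=
  ((Finset.univ.filter fun w : (m : Fin M) → Fin (L m) =>
      c.dec k (fun t : Fin N => c.output ch w t k) ≠ w).card : ℝ) /
    (Fintype.card ((m : Fin M) → Fin (L m)) : ℝ)

end FeedbackCode

/-- The rate tuple `R` (in bits per channel use) is achievable with feedback: there are feedback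
codes with `⌈2 ^ (N * R m)⌉` messages at transmitter `m`, one for each length `N`, whose
average error probabilities at all receivers tend to `0` as `N → ∞`. -/
def Achievable {M K : ℕ} {X Y : Type*} (ch : (Fin M → X) → Fin K → Y) (R : Fin M → ℝ) : Prop :=
  (∀ m, 0 ≤ R m) ∧
    ∃ c : (N : ℕ) → FeedbackCode M K X Y N (fun m => ⌈(2 : ℝ) ^ ((N : ℝ) * R m)⌉₊),
      ∀ k, Filter.Tendsto (fun N => (c N).errorProb ch k) Filter.atTop (nhds 0)

/-- The feedback capacity region: the closure of the set of achievable rate tuples. -/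
def feedbackCapacityRegion {M K : ℕ} {X Y : Type*} (ch : (Fin M → X) → Fin K → Y) :
    Set (Fin M → ℝ) :=
  closure {R | Achievable ch R}

/-! ### The Avestimehr-Diggavi-Tse multicast channel

`n m k` is the number of signal bit levels from transmitter `m` to receiver `k`. -/

/-- The length of the binary input and output vectors: the largest of all the `n m k`. -/
def levels {M K : ℕ} (n : Fin M → Fin K → ℕ) : ℕ :=
  Finset.univ.sup fun m => Finset.univ.sup fun k => n m k

/-- The `q × q` down-shift matrix over `𝔽₂`. -/
def shift (q : ℕ) : Matrix (Fin q) (Fin q) (ZMod 2) :=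
  Matrix.of fun i j => if (i : ℕ) = (j : ℕ) + 1 then 1 else 0

/-- The transfer matrix from transmitter `m` to receiver `k`: the shift by `q - n m k`, so that
the receiver sees, at its lowest levels, the `n m k` top bits of the input. -/
def link {M K : ℕ} (n : Fin M → Fin K → ℕ) (m : Fin M) (k : Fin K) :
    Matrix (Fin (levels n)) (Fin (levels n)) (ZMod 2) :=
  shift (levels n) ^ (levels n - n m k)

/-- The ADT channel `Y_k = ∑ m, S ^ (q - n m k) X_m`, with addition modulo 2. -/
def channel {M K : ℕ} (n : Fin M → Fin K → ℕ) (x : Fin M → Fin (levels n) → ZMod 2)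
    (k : Fin K) : Fin (levels n) → ZMod 2 :=
  ∑ m, (link n m k).mulVec (x m)

/-- The matrix `G_S` from the inputs of the transmitters in `S`, stacked, to the outputs of all
receivers, stacked. -/
def transfer {M K : ℕ} (n : Fin M → Fin K → ℕ) (S : Finset (Fin M)) :
    Matrix (Fin K × Fin (levels n)) (S × Fin (levels n)) (ZMod 2) :=
  Matrix.of fun r s => link n s.1 r.1 r.2 s.2

/-- The defining property of the matrices `G_S`: `Y = G_S X_S + G_{Sᶜ} X_{Sᶜ}`. -/
theorem channel_eq_transfer {M K : ℕ} (n : Fin M → Fin K → ℕ) (S : Finset (Fin M))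
    (x : Fin M → Fin (levels n) → ZMod 2) :
    (fun r : Fin K × Fin (levels n) => channel n x r.1 r.2) =
      (transfer n S).mulVec (fun s => x s.1 s.2) +
        (transfer n Sᶜ).mulVec (fun s => x s.1 s.2) := by
  funext r
  simp only [channel, transfer, Matrix.mulVec, dotProduct, Matrix.of_apply, Pi.add_apply,
    Fintype.sum_prod_type, Finset.sum_apply]
  rw [Finset.sum_coe_sort S (fun m => ∑ j, link n m r.1 r.2 j * x m j),
    Finset.sum_coe_sort Sᶜ (fun m => ∑ j, link n m r.1 r.2 j * x m j),
    Finset.sum_add_sum_compl]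

end ADTMulticast

namespace ADTMulticast

/-! Converse, by counting correctly decoded message tuples. Fix the messages outside `S` and the
sequence of vectors `G_S X_S`: by induction on time these determine all outputs, since the feedback
and hence the inputs outside `S` are known. This leaves at most `2 ^ (N * rank G_S)` tuples
(`card_correct_le_rank`). Receiver `k` sees only its `strength n k` lowest levels, so it
distinguishes at most `2 ^ (N * strength n k)` tuples (`card_correct_le_strength`).
`Achievable.sum_le` turns such counts into rate bounds.

Achievability, by zero-error block Markov coding (`exists_code_of_block`). In each block,
transmitter `m` sends a linear encoding of its fresh bits plus its share of a joint linear encoding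
of all bits of the previous block, which every transmitter has learned from feedback. A transmitter
knows its own message, so two candidates differ on a proper subset `S`, and only ranks of proper
subsets matter. Receivers decode backwards: when the fresh bits of a block are known, the old bits
are sent by fully cooperating transmitters, limited only by `strength n k`. A union bound over
random linear maps supplies both encoders (`exists_fresh_encoder`, `exists_joint_encoder`). Scaling
by `t < 1` leaves room for the losses, and the closure recovers `t = 1`. -/

theorem shift_pow_apply (q e : ℕ) (i j : Fin q) :
    (shift q ^ e) i j = if (i : ℕ) = (j : ℕ) + e then 1 else 0 := by
  induction e generalizing i j with
  | zero => simp [Matrix.one_apply, Fin.ext_iff]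
  | succ e ih =>
    rw [pow_succ, Matrix.mul_apply]
    have hs : ∀ a b : Fin q, shift q a b = if (a : ℕ) = (b : ℕ) + 1 then 1 else 0 :=
      fun _ _ => rfl
    simp only [ih, hs]
    by_cases h : (i : ℕ) = (j : ℕ) + (e + 1)
    · have hj : (j : ℕ) + 1 < q := by omega
      rw [if_pos h, Finset.sum_eq_single ⟨(j : ℕ) + 1, hj⟩]
      · rw [if_pos (show (i : ℕ) = (j : ℕ) + 1 + e by omega), if_pos rfl, one_mul]
      · intro l _ hl
        rw [if_neg (fun h' => hl (Fin.ext h')), mul_zero]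
      · simp
    · rw [if_neg h]
      refine Finset.sum_eq_zero fun l _ => ?_
      by_cases h' : (l : ℕ) = (j : ℕ) + 1
      · rw [if_neg (by omega), zero_mul]
      · rw [if_neg h', mul_zero]

/-! ### Ranges of the channel maps and their cardinalities -/

variable {M K : ℕ} (n : Fin M → Fin K → ℕ)

/-- The number of levels that receiver `k` sees. -/
def strength (k : Fin K) : ℕ := Finset.univ.sup fun m => n m k

theorem le_strength (m : Fin M) (k : Fin K) : n m k ≤ strength n k :=
  Finset.le_sup (f := fun m => n m k) (Finset.mem_univ m)

theorem strength_le_levels (k : Fin K) : strength n k ≤ levels n :=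
  Finset.sup_mono_fun fun _ _ => Finset.le_sup (f := fun k => n _ k) (Finset.mem_univ k)

/-- The channel as a linear map. -/
def channelHom : (Fin M → Fin (levels n) → ZMod 2) →ₗ[ZMod 2]
    (Fin K → Fin (levels n) → ZMod 2) where
  toFun := channel n
  map_add' x y := by
    funext k
    simp [channel, Matrix.mulVec_add, Finset.sum_add_distrib]
  map_smul' a x := by
    funext k
    simp [channel, Matrix.mulVec_smul, Finset.smul_sum]

@[simp] theorem channelHom_apply (x : Fin M → Fin (levels n) → ZMod 2) :
    channelHom n x = channel n x := rfl

/-- The vectors that receiver `k` may see: those that vanish above its level. -/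
def outputSpace (k : Fin K) : Set (Fin (levels n) → ZMod 2) :=
  {y | ∀ i : Fin (levels n), (i : ℕ) < levels n - strength n k → y i = 0}

/-- The output vectors of receiver `k` are described by their lowest levels. -/
def outputSpaceEquiv (k : Fin K) : outputSpace n k ≃ (Fin (strength n k) → ZMod 2) where
  toFun y i := y.1 ⟨levels n - strength n k + i, by
    have := strength_le_levels n k; have := i.2; omega⟩
  invFun z := ⟨fun i => if h : levels n - strength n k ≤ (i : ℕ) then
      z ⟨(i : ℕ) - (levels n - strength n k), by
        have := strength_le_levels n k; have := i.2; omega⟩ else 0, fun i hi => by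
      exact dif_neg (by omega)⟩
  left_inv y := by
    apply Subtype.ext
    funext i
    by_cases h : levels n - strength n k ≤ (i : ℕ)
    · simp only [dif_pos h]
      exact congrArg y.1 (Fin.ext (Nat.add_sub_cancel' h))
    · simp only [dif_neg h]
      exact (y.2 i (by omega)).symm
  right_inv z := by
    funext i
    simp

theorem card_outputSpace (k : Fin K) : Nat.card (outputSpace n k) = 2 ^ strength n k := by
  rw [Nat.card_congr (outputSpaceEquiv n k)]
  simp

theorem channel_mem_outputSpace (x : Fin M → Fin (levels n) → ZMod 2) (k : Fin K) :
    channel n x k ∈ outputSpace n k := by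
  intro i hi
  simp only [channel, Finset.sum_apply, Matrix.mulVec, dotProduct]
  refine Finset.sum_eq_zero fun m _ => Finset.sum_eq_zero fun j _ => ?_
  have := le_strength n m k
  rw [link, shift_pow_apply, if_neg (by omega), zero_mul]

/-- The strongest transmitter for receiver `k` suffices: it sends `y` shifted up while the others
stay silent. -/
theorem exists_channel_eq (hM : 1 ≤ M) (k : Fin K) {y : Fin (levels n) → ZMod 2}
    (hy : y ∈ outputSpace n k) : ∃ x, channel n x k = y := by
  obtain ⟨m, -, hm⟩ := Finset.exists_mem_eq_sup (Finset.univ : Finset (Fin M))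
    ⟨⟨0, hM⟩, Finset.mem_univ _⟩ (fun m => n m k)
  have hm' : strength n k = n m k := hm
  refine ⟨Pi.single m fun j => if h : (j : ℕ) + (levels n - n m k) < levels n then
    y ⟨(j : ℕ) + (levels n - n m k), h⟩ else 0, ?_⟩
  rw [channel, Finset.sum_eq_single m]
  · funext i
    simp only [Pi.single_eq_same, Matrix.mulVec, dotProduct, link, shift_pow_apply]
    by_cases h : (i : ℕ) < levels n - n m k
    · rw [hy i (by omega)]
      refine Finset.sum_eq_zero fun j _ => ?_
      rw [if_neg (by omega), zero_mul]
    · have hi := i.2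
      rw [Finset.sum_eq_single ⟨(i : ℕ) - (levels n - n m k), by omega⟩]
      · have h1 : (i : ℕ) - (levels n - n m k) + (levels n - n m k) = i := by omega
        simp [h1]
      · intro j _ hj
        rw [if_neg, zero_mul]
        intro h'
        apply hj
        apply Fin.ext
        simp only
        omega
      · simp
  · intro m' _ hm'
    rw [Pi.single_eq_of_ne hm', Matrix.mulVec_zero]
  · simp

theorem card_range_transfer (S : Finset (Fin M)) :
    Nat.card (LinearMap.range (transfer n S).mulVecLin) = 2 ^ (transfer n S).rank := by
  rw [Nat.card_eq_fintype_card, Module.card_eq_pow_finrank (K := ZMod 2), ZMod.card]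
  rfl

end ADTMulticast

/-! ### Converse: counting correctly decoded messages -/

namespace ADTMulticast

namespace FeedbackCode

variable {M K : ℕ} {X Y : Type*} {N : ℕ} {L : Fin M → ℕ}

/-- The messages that receiver `k` decodes correctly. -/
def correct (c : FeedbackCode M K X Y N L) (ch : (Fin M → X) → Fin K → Y)
    (k : Fin K) : Set ((m : Fin M) → Fin (L m)) :=
  {w | c.dec k (fun t : Fin N => c.output ch w t k) = w}

theorem eq_of_mem_correct (c : FeedbackCode M K X Y N L) (ch : (Fin M → X) → Fin K → Y)
    (k : Fin K) {w w' : (m : Fin M) → Fin (L m)} (hw : w ∈ c.correct ch k)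
    (hw' : w' ∈ c.correct ch k) (h : ∀ t < N, c.output ch w t k = c.output ch w' t k) :
    w = w' := by
  have h1 : c.dec k (fun t : Fin N => c.output ch w t k) = w := hw
  have h2 : c.dec k (fun t : Fin N => c.output ch w' t k) = w' := hw'
  rw [← h1, ← h2]
  congr 1
  funext t
  exact h t t.2

theorem one_sub_errorProb_mul (c : FeedbackCode M K X Y N L) (ch : (Fin M → X) → Fin K → Y)
    (k : Fin K) (hL : ∀ m, 0 < L m) :
    (1 - c.errorProb ch k) * ∏ m, (L m : ℝ) = Nat.card (c.correct ch k) := by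
  classical
  have hpos : (0 : ℝ) < ∏ m, (L m : ℝ) := Finset.prod_pos fun m _ => by exact_mod_cast hL m
  have hcard : (Fintype.card ((m : Fin M) → Fin (L m)) : ℝ) = ∏ m, (L m : ℝ) := by
    simp [Fintype.card_pi]
  have hC : Nat.card (c.correct ch k) = (Finset.univ.filter fun w : (m : Fin M) → Fin (L m) =>
      c.dec k (fun t : Fin N => c.output ch w t k) = w).card := by
    rw [Nat.card_eq_fintype_card, ← Set.toFinset_card]
    congr 1
    ext w
    rw [Set.mem_toFinset]
    simp [correct]
  have hsum := Finset.card_filter_add_card_filter_not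
    (s := (Finset.univ : Finset ((m : Fin M) → Fin (L m)))) (fun w => c.dec k (fun t : Fin N => c.output ch w t k) = w)
  rw [Finset.card_univ] at hsum
  rw [errorProb, hcard, sub_mul, one_mul, div_mul_cancel₀ _ hpos.ne', hC, ← hcard, ← hsum]
  push_cast
  have : ∀ a b c : ℝ, b = c → a + b - c = a := by intros; linarith
  apply this
  congr 2

end FeedbackCode

variable {M K : ℕ}

/-- If the correctly decoded messages number at most `2 ^ (N * r)` for each choice of the messages
outside `S`, then the rates of achievable tuples sum to at most `r` on `S`. -/
theorem Achievable.sum_le {X Y : Type*} {ch : (Fin M → X) → Fin K → Y} {R : Fin M → ℝ}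
    (h : Achievable ch R) (S : Finset (Fin M)) (k : Fin K) (r : ℕ)
    (hr : ∀ (N : ℕ) (L : Fin M → ℕ) (c : FeedbackCode M K X Y N L),
      Nat.card (c.correct ch k) ≤ (∏ m ∈ Sᶜ, L m) * (2 ^ r) ^ N) :
    ∑ m ∈ S, R m ≤ r := by
  obtain ⟨-, c, hc⟩ := h
  by_contra hlt
  push Not at hlt
  -- For this `N` more than half of the tuples are decoded correctly, while the excess rate gives a
  -- factor of at least `2` over the count allowed by `hr`.
  obtain ⟨N, hN, hN'⟩ := (((hc k).eventually (gt_mem_nhds (show (0 : ℝ) < 1 / 2 by norm_num))).and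
    ((tendsto_natCast_atTop_atTop.atTop_mul_const
      (sub_pos.2 hlt)).eventually_ge_atTop 1)).exists
  have hL : ∀ m, (2 : ℝ) ^ ((N : ℝ) * R m) ≤ (⌈(2 : ℝ) ^ ((N : ℝ) * R m)⌉₊ : ℝ) :=
    fun m => Nat.le_ceil _
  have hpos : ∀ m, 0 < ⌈(2 : ℝ) ^ ((N : ℝ) * R m)⌉₊ := fun m => Nat.ceil_pos.2 (by positivity)
  have h1 := (c N).one_sub_errorProb_mul ch k hpos
  have h2 : (Nat.card ((c N).correct ch k) : ℝ) ≤ _ := Nat.cast_le.2 (hr N _ (c N))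
  rw [← h1, ← Finset.prod_mul_prod_compl S] at h2
  push_cast at h2
  have hQ : (0 : ℝ) < ∏ m ∈ Sᶜ, (⌈(2 : ℝ) ^ ((N : ℝ) * R m)⌉₊ : ℝ) :=
    Finset.prod_pos fun m _ => by exact_mod_cast hpos m
  have h3 : (1 - (c N).errorProb ch k) * ∏ m ∈ S, (⌈(2 : ℝ) ^ ((N : ℝ) * R m)⌉₊ : ℝ)
      ≤ (2 ^ r) ^ N := by
    refine le_of_mul_le_mul_right ?_ hQ
    calc _ = _ := by rw [mul_assoc]
      _ ≤ _ := h2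
      _ = _ := by rw [mul_comm]
  have h4 : (2 : ℝ) ^ ((N : ℝ) * ∑ m ∈ S, R m) ≤
      ∏ m ∈ S, (⌈(2 : ℝ) ^ ((N : ℝ) * R m)⌉₊ : ℝ) := by
    rw [Finset.mul_sum, Real.rpow_sum_of_pos two_pos]
    exact Finset.prod_le_prod (fun m _ => by positivity) fun m _ => hL m
  have h5 : (2 : ℝ) ^ ((N : ℝ) * r) * 2 ≤ (2 : ℝ) ^ ((N : ℝ) * ∑ m ∈ S, R m) := by
    have : (2 : ℝ) ^ ((N : ℝ) * r) * 2 = (2 : ℝ) ^ ((N : ℝ) * r + 1) := by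
      rw [Real.rpow_add two_pos, Real.rpow_one]
    rw [this]
    exact Real.rpow_le_rpow_of_exponent_le one_le_two (by nlinarith)
  have h6 : (2 : ℝ) ^ ((N : ℝ) * r) = (2 ^ r) ^ N := by
    rw [mul_comm, Real.rpow_mul two_pos.le, Real.rpow_natCast, Real.rpow_natCast]
  have h7 : (0 : ℝ) < (2 ^ r) ^ N := by positivity
  nlinarith

variable (n : Fin M → Fin K → ℕ)

/-- A correct tuple is recovered from its part outside `S` and the contributions of `S` to the
output at each time: equal past outputs force equal inputs outside `S`, hence equal next outputs. -/
theorem card_correct_le_rank (S : Finset (Fin M)) (k : Fin K) (N : ℕ) (L : Fin M → ℕ)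
    (c : FeedbackCode M K (Fin (levels n) → ZMod 2) (Fin (levels n) → ZMod 2) N L) :
    Nat.card (c.correct (channel n) k) ≤ (∏ m ∈ Sᶜ, L m) * (2 ^ (transfer n S).rank) ^ N := by
  have hcard : Nat.card (((m : (Sᶜ : Finset (Fin M))) → Fin (L m)) ×
      (Fin N → LinearMap.range (transfer n S).mulVecLin)) =
      (∏ m ∈ Sᶜ, L m) * (2 ^ (transfer n S).rank) ^ N := by
    rw [Nat.card_prod, Nat.card_pi, Nat.card_fun, card_range_transfer]
    simp only [Nat.card_eq_fintype_card, Fintype.card_fin]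
    rw [Finset.prod_coe_sort Sᶜ L]
  rw [← hcard]
  let inp (w : (m : Fin M) → Fin (L m)) (t : ℕ) (m : Fin M) : Fin (levels n) → ZMod 2 :=
    c.enc m t (w m) fun s : Fin t => c.output (channel n) w s
  refine Nat.card_le_card_of_injective (fun w : c.correct (channel n) k =>
    (fun m => w.1 m, fun t => ⟨(transfer n S).mulVecLin fun s => inp w.1 t s.1 s.2,
      LinearMap.mem_range_self _ _⟩)) ?_
  intro w w' h
  simp only [Prod.mk.injEq] at h
  obtain ⟨h1, h2⟩ := h
  have hout : ∀ t < N, c.output (channel n) w.1 t = c.output (channel n) w'.1 t := by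
    intro t
    induction t using Nat.strong_induction_on with
    | _ t ih =>
      intro ht
      have hc : ∀ m ∈ Sᶜ, inp w.1 t m = inp w'.1 t m := by
        intro m hm
        have hw : w.1 m = w'.1 m := congrFun h1 ⟨m, hm⟩
        have hp : (fun s : Fin t => c.output (channel n) w.1 s) =
            fun s : Fin t => c.output (channel n) w'.1 s := by
          funext s
          exact ih s s.2 (s.2.trans ht)
        simp only [inp, hw, hp]
      have hS : (transfer n S).mulVec (fun s => inp w.1 t s.1 s.2) =
          (transfer n S).mulVec (fun s => inp w'.1 t s.1 s.2) :=
        congrArg Subtype.val (congrFun h2 ⟨t, ht⟩)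
      have hSc : (fun s : (Sᶜ : Finset (Fin M)) × Fin (levels n) => inp w.1 t s.1 s.2) =
          fun s => inp w'.1 t s.1 s.2 := by
        funext s
        rw [hc s.1 s.1.2]
      have e := channel_eq_transfer n S (inp w.1 t)
      rw [hS, hSc, ← channel_eq_transfer n S (inp w'.1 t)] at e
      rw [FeedbackCode.output, FeedbackCode.output]
      funext k' i
      exact congrFun e (k', i)
  exact Subtype.ext (c.eq_of_mem_correct _ k w.2 w'.2 fun t ht => congrFun (hout t ht) k)

theorem card_correct_le_strength (k : Fin K) (N : ℕ) (L : Fin M → ℕ)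
    (c : FeedbackCode M K (Fin (levels n) → ZMod 2) (Fin (levels n) → ZMod 2) N L) :
    Nat.card (c.correct (channel n) k) ≤ (2 ^ strength n k) ^ N := by
  have hcard : Nat.card (Fin N → outputSpace n k) = (2 ^ strength n k) ^ N := by
    rw [Nat.card_fun, card_outputSpace, Nat.card_eq_fintype_card, Fintype.card_fin]
  rw [← hcard]
  refine Nat.card_le_card_of_injective (fun (w : c.correct (channel n) k) (t : Fin N) =>
    (⟨c.output (channel n) w.1 t k, by
      rw [FeedbackCode.output]; exact channel_mem_outputSpace n _ k⟩ : outputSpace n k)) ?_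
  intro w w' h
  exact Subtype.ext (c.eq_of_mem_correct _ k w.2 w'.2 fun t ht =>
    congrArg Subtype.val (congrFun h ⟨t, ht⟩))

end ADTMulticast

/-! ### Block Markov coding -/

namespace ADTMulticast

/-- An input assignment `x` that respects the feedback constraint, and whose outputs identify the
messages at each receiver, is realized by a code without errors. -/
theorem exists_code_errorProb_eq_zero {M K : ℕ} {X Y : Type*} (ch : (Fin M → X) → Fin K → Y)
    (N : ℕ) (L : Fin M → ℕ) (x : ((m : Fin M) → Fin (L m)) → ℕ → Fin M → X)
    (w₀ : (m : Fin M) → Fin (L m))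
    (hcausal : ∀ m i w w', w m = w' m → (∀ t < i, ch (x w t) = ch (x w' t)) →
      x w i m = x w' i m)
    (hdec : ∀ k w w', (∀ t < N, ch (x w t) k = ch (x w' t) k) → w = w') :
    ∃ c : FeedbackCode M K X Y N L, ∀ k, c.errorProb ch k = 0 := by
  classical
  -- Encoder and decoder pick any message tuple consistent with what they know; `hcausal` and `hdec`
  -- make the choice harmless. The default `w₀` is never used on outputs that occur.
  let c : FeedbackCode M K X Y N L :=
    { enc := fun m i a y =>
        if h : ∃ w, w m = a ∧ ∀ t : Fin i, ch (x w t) = y t then x h.choose i m else x w₀ i m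
      dec := fun k y => if h : ∃ w, ∀ t : Fin N, ch (x w t) k = y t then h.choose else w₀ }
  have hout : ∀ w i, c.output ch w i = ch (x w i) := by
    intro w i
    induction i using Nat.strong_induction_on with
    | _ i ih =>
      rw [FeedbackCode.output]
      congr 1
      funext m
      have h : ∃ w', w' m = w m ∧ ∀ t : Fin i, ch (x w' t) = c.output ch w t :=
        ⟨w, rfl, fun t => (ih t t.2).symm⟩
      change (if h : ∃ w', w' m = w m ∧ ∀ t : Fin i, ch (x w' t) = c.output ch w t then
        x h.choose i m else x w₀ i m) = x w i m
      rw [dif_pos h]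
      exact hcausal m i _ _ h.choose_spec.1 fun t ht =>
        (h.choose_spec.2 ⟨t, ht⟩).trans (ih t ht)
  refine ⟨c, fun k => ?_⟩
  have hcorrect : ∀ w, c.dec k (fun t : Fin N => c.output ch w t k) = w := by
    intro w
    have h : ∃ w', ∀ t : Fin N, ch (x w' t) k = c.output ch w t k :=
      ⟨w, fun t => by rw [hout]⟩
    change (if h : ∃ w', ∀ t : Fin N, ch (x w' t) k = c.output ch w t k then
        h.choose else w₀) = w
    rw [dif_pos h]
    refine hdec k _ _ fun t ht => ?_
    have := h.choose_spec ⟨t, ht⟩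
    rw [this, hout]
  simp [FeedbackCode.errorProb, hcorrect]

/-- Block Markov coding. In each block of length `l`, transmitter `m` sends an input that depends
on its own fresh message and on all messages of the block before. If each transmitter can decode
all fresh messages from the outputs, and each receiver can decode the old messages when it knows
the fresh ones, then `B` message tuples can be sent without error in `B + 1` blocks. -/
theorem exists_code_of_block {M K : ℕ} {X Y : Type*} (ch : (Fin M → X) → Fin K → Y)
    {U : Fin M → Type*} [∀ m, Fintype (U m)] (u₀ : (m : Fin M) → U m) (l : ℕ) (hl : 0 < l)
    (e : (m : Fin M) → U m → ((m : Fin M) → U m) → ℕ → X)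
    (htrans : ∀ m (old u u' : (m : Fin M) → U m), u m = u' m →
      (∀ t < l, ch (fun m => e m (u m) old t) = ch (fun m => e m (u' m) old t)) → u = u')
    (hrec : ∀ k (u old old' : (m : Fin M) → U m),
      (∀ t < l, ch (fun m => e m (u m) old t) k = ch (fun m => e m (u m) old' t) k) → old = old')
    (B N : ℕ) (hN : (B + 1) * l ≤ N) (L : Fin M → ℕ) (hL : ∀ m, 0 < L m)
    (hLU : ∀ m, L m ≤ Fintype.card (U m) ^ B) :
    ∃ c : FeedbackCode M K X Y N L, ∀ k, c.errorProb ch k = 0 := by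
  classical
  have hemb : ∀ m, Nonempty (Fin (L m) ↪ (Fin B → U m)) := fun m =>
    Function.Embedding.nonempty_of_card_le (by simpa using hLU m)
  let ι (m : Fin M) : Fin (L m) ↪ (Fin B → U m) := (hemb m).some
  -- The fixed `u₀` stands in for the fresh messages of block `B` and the old messages of block `0`:
  -- it starts the forward decoding at the transmitters and the backward decoding at the receivers.
  let fresh (w : (m : Fin M) → Fin (L m)) (b : ℕ) (m : Fin M) : U m :=
    if h : b < B then ι m (w m) ⟨b, h⟩ else u₀ m
  let old (w : (m : Fin M) → Fin (L m)) (b : ℕ) (m : Fin M) : U m :=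
    if b = 0 then u₀ m else fresh w (b - 1) m
  let x (w : (m : Fin M) → Fin (L m)) (i : ℕ) (m : Fin M) : X :=
    e m (fresh w (i / l) m) (old w (i / l)) (i % l)
  have hx : ∀ w b t, t < l →
      x w (b * l + t) = fun m => e m (fresh w b m) (old w b) t := by
    intro w b t ht
    funext m
    have h1 : (b * l + t) / l = b := by
      rw [mul_comm, Nat.mul_add_div hl, Nat.div_eq_of_lt ht, add_zero]
    have h2 : (b * l + t) % l = t := by
      rw [mul_comm, Nat.mul_add_mod, Nat.mod_eq_of_lt ht]
    simp only [x, h1, h2]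
  have hfresh : ∀ m w w', w m = w' m → ∀ b, fresh w b m = fresh w' b m := by
    intro m w w' h b
    simp only [fresh, h]
  have hold : ∀ w b, old w (b + 1) = fresh w b := by
    intro w b
    funext m
    simp [old]
  refine exists_code_errorProb_eq_zero ch N L x (fun m => ⟨0, hL m⟩) ?_ ?_
  · intro m i w w' hm hout
    -- Forward decoding at transmitter `m`: each completed block reveals the old messages of the
    -- next.
    have key : ∀ b, b * l ≤ i → old w b = old w' b := by
      intro b
      induction b with
      | zero => intro; funext m; simp [old]
      | succ b ih =>
        intro hb
        have hb' : b * l + l ≤ i := by rw [← Nat.succ_mul]; exact hb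
        rw [hold, hold]
        refine htrans m (old w b) _ _ (hfresh m w w' hm b) fun t ht => ?_
        have := hout (b * l + t) (by omega)
        rw [hx w b t ht, hx w' b t ht, ← ih (by omega)] at this
        exact this
    simp only [x]
    rw [hfresh m w w' hm, key (i / l) (Nat.div_mul_le_self i l)]
  · intro k w w' hout
    -- Backward decoding: `j` counts blocks from the last one, and the old messages of a block are
    -- the fresh ones of its predecessor.
    have key : ∀ j ≤ B, fresh w (B - j) = fresh w' (B - j) := by
      intro j
      induction j with
      | zero => intro; funext m; simp [fresh]
      | succ j ih =>
        intro hj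
        have hb : B - j = (B - (j + 1)) + 1 := by omega
        have ih' := ih (by omega)
        rw [← hold, ← hold, ← hb]
        refine hrec k (fresh w (B - j)) _ _ fun t ht => ?_
        have hlt : (B - j) * l + t < N := by
          have : (B - j) * l ≤ B * l := Nat.mul_le_mul_right l (by omega)
          rw [Nat.succ_mul] at hN
          omega
        have := hout _ hlt
        rw [hx w _ t ht, hx w' _ t ht, ← ih'] at this
        exact this
    funext m
    apply (ι m).injective
    funext b
    have := congrFun (key (B - b) (by omega)) m
    have hb : B - (B - (b : ℕ)) = b := by omega
    rw [hb] at this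
    simpa [fresh] using this

end ADTMulticast

/-! ### Random linear encoders -/

namespace ADTMulticast

/-- Union bound: finitely many homomorphisms with large ranges do not vanish simultaneously
at some point. -/
theorem exists_forall_apply_ne_zero {Ω O ι : Type*} [AddCommGroup Ω] [Finite Ω] [AddCommGroup O]
    (s : Finset ι) (Φ : ι → Ω →+ O) (h : ∑ i ∈ s, (1 / Nat.card (Φ i).range : ℝ) < 1) :
    ∃ a, ∀ i ∈ s, Φ i a ≠ 0 := by
  classical
  by_contra hcon
  push Not at hcon
  have := Fintype.ofFinite Ω
  -- Each kernel is a fraction `1 / |range|` of `Ω`, so the kernels together are too small to cover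
  -- it.
  have hpos : (0 : ℝ) < Nat.card Ω := by exact_mod_cast Nat.card_pos
  have hker : ∀ i, (Nat.card (Φ i).ker : ℝ) = Nat.card Ω * (1 / Nat.card (Φ i).range) := by
    intro i
    have h1 := (Φ i).ker.card_mul_index
    rw [AddSubgroup.index_ker] at h1
    have h2 : (Nat.card (Φ i).range : ℝ) ≠ 0 := by
      have : 0 < Nat.card (Φ i).range := by
        have : Finite (Φ i).range := Set.finite_range (Φ i)
        exact Nat.card_pos
      positivity
    rw [mul_one_div, eq_div_iff h2]
    exact_mod_cast h1
  have hcover : Nat.card Ω ≤ ∑ i ∈ s, Nat.card (Φ i).ker := by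
    have hsub : (Finset.univ : Finset Ω) ⊆ s.biUnion fun i =>
        Finset.univ.filter fun a => Φ i a = 0 := by
      intro a _
      obtain ⟨i, hi, ha⟩ := hcon a
      simpa using ⟨i, hi, ha⟩
    calc Nat.card Ω = (Finset.univ : Finset Ω).card := by simp
      _ ≤ _ := Finset.card_le_card hsub
      _ ≤ _ := Finset.card_biUnion_le
      _ = _ := by
        refine Finset.sum_congr rfl fun i _ => ?_
        rw [Nat.card_eq_fintype_card, Fintype.card_subtype]
        simp [AddMonoidHom.mem_ker]
  have : (Nat.card Ω : ℝ) ≤ Nat.card Ω * ∑ i ∈ s, (1 / Nat.card (Φ i).range : ℝ) := by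
    rw [Finset.mul_sum, ← Finset.sum_congr rfl fun i _ => hker i]
    exact_mod_cast hcover
  nlinarith

/-- A random linear encoder can therefore take any value at a nonzero message, which makes the
ranges in the union bounds large. -/
theorem exists_linearMap_apply_eq {ι V : Type*} [AddCommGroup V] [Module (ZMod 2) V]
    {u : ι → ZMod 2} (hu : u ≠ 0) (v : V) : ∃ f : (ι → ZMod 2) →ₗ[ZMod 2] V, f u = v := by
  obtain ⟨j, hj⟩ := Function.ne_iff.1 hu
  refine ⟨(LinearMap.proj j).smulRight v, ?_⟩
  have h1 : u j = 1 := by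
    have : ∀ a : ZMod 2, a ≠ 0 → a = 1 := by decide
    exact this _ hj
  simp [h1]

variable {M K : ℕ} (n : Fin M → Fin K → ℕ)

/-- Linear encoders for the fresh messages: the outputs of all receivers determine all messages
for a transmitter that knows one of them. -/
theorem exists_fresh_encoder (d : Fin M → ℕ) (l c : ℕ) (hc : M < c)
    (hd : ∀ S : Finset (Fin M), S ⊂ Finset.univ → S.Nonempty → (∀ m ∈ S, 0 < d m) →
      ∑ m ∈ S, d m + c ≤ l * (transfer n S).rank) :
    ∃ A : (m : Fin M) → (Fin (d m) → ZMod 2) →ₗ[ZMod 2] (Fin l → Fin (levels n) → ZMod 2),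
      ∀ u : (m : Fin M) → Fin (d m) → ZMod 2, u ≠ 0 → (∃ m, u m = 0) →
        ∃ t, channel n (fun m => A m (u m) t) ≠ 0 := by
  classical
  let Ω := (m : Fin M) → (Fin (d m) → ZMod 2) →ₗ[ZMod 2] (Fin l → Fin (levels n) → ZMod 2)
  have : Finite Ω := by
    have : ∀ m, Finite ((Fin (d m) → ZMod 2) →ₗ[ZMod 2] (Fin l → Fin (levels n) → ZMod 2)) :=
      fun m => Finite.of_injective _ (DFunLike.coe_injective)
    infer_instance
  let Φ (u : (m : Fin M) → Fin (d m) → ZMod 2) :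
      Ω →+ (Fin l → Fin K → Fin (levels n) → ZMod 2) :=
    { toFun := fun A t => channelHom n fun m => A m (u m) t
      map_zero' := by
        funext t
        exact map_zero (channelHom n)
      map_add' := fun A A' => by
        funext t
        exact map_add (channelHom n) _ _ }
  let supp (u : (m : Fin M) → Fin (d m) → ZMod 2) : Finset (Fin M) :=
    Finset.univ.filter fun m => u m ≠ 0
  let s : Finset ((m : Fin M) → Fin (d m) → ZMod 2) :=
    Finset.univ.filter fun u => u ≠ 0 ∧ ∃ m, u m = 0
  -- On the support of `u` the inputs `A m (u m)` are arbitrary, so the outputs fill `l` copies of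
  -- the range of `G_S` with `S = supp u`, a proper subset because some `u m` vanishes.
  have hrange : ∀ u ∈ s, 2 ^ (∑ m ∈ supp u, d m + c) ≤ Nat.card (Φ u).range := by
    intro u hu
    obtain ⟨hu0, m₀, hm₀⟩ := (Finset.mem_filter.1 hu).2
    have hS : supp u ⊂ Finset.univ :=
      Finset.ssubset_univ_iff.2 fun h => by
        have : m₀ ∈ supp u := h ▸ Finset.mem_univ _
        exact (Finset.mem_filter.1 this).2 hm₀
    have hne : (supp u).Nonempty := by
      obtain ⟨m, hm⟩ := Function.ne_iff.1 hu0
      exact ⟨m, Finset.mem_filter.2 ⟨Finset.mem_univ _, hm⟩⟩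
    have hdpos : ∀ m ∈ supp u, 0 < d m := by
      intro m hm
      obtain ⟨j, -⟩ := Function.ne_iff.1 (Finset.mem_filter.1 hm).2
      exact j.pos
    refine (Nat.pow_le_pow_right two_pos (hd _ hS hne hdpos)).trans ?_
    have hcard : Nat.card (Fin l → LinearMap.range (transfer n (supp u)).mulVecLin) =
        2 ^ (l * (transfer n (supp u)).rank) := by
      rw [Nat.card_fun, card_range_transfer, Nat.card_eq_fintype_card, Fintype.card_fin,
        ← pow_mul, mul_comm]
    rw [← hcard]
    have : Finite (Φ u).range := Set.finite_range (Φ u)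
    have hex : ∀ y : Fin l → LinearMap.range (transfer n (supp u)).mulVecLin,
        ∃ A : Ω, ∀ t r, Φ u A t r.1 r.2 = (y t).1 r := by
      intro y
      choose z hz using fun t => (y t).2
      have hA : ∀ m, ∃ f : (Fin (d m) → ZMod 2) →ₗ[ZMod 2] (Fin l → Fin (levels n) → ZMod 2),
          f (u m) = fun t j => if h : m ∈ supp u then z t (⟨m, h⟩, j) else 0 := by
        intro m
        by_cases h : m ∈ supp u
        · exact exists_linearMap_apply_eq (Finset.mem_filter.1 h).2 _
        · refine ⟨0, ?_⟩
          funext t j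
          simp [h]
      choose A hA using hA
      refine ⟨A, fun t r => ?_⟩
      have h1 := congrFun (channel_eq_transfer n (supp u) fun m => A m (u m) t) r
      have h2 : (fun s : supp u × Fin (levels n) => A s.1 (u s.1) t s.2) =
          z t := by
        funext s
        rw [hA s.1]
        exact dif_pos s.1.2
      have h3 : (fun s : ((supp u)ᶜ : Finset (Fin M)) × Fin (levels n) =>
          A s.1 (u s.1) t s.2) = 0 := by
        funext s
        rw [hA s.1]
        exact dif_neg (Finset.mem_compl.1 s.1.2)
      rw [h2, h3, Matrix.mulVec_zero, add_zero] at h1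
      exact h1.trans (congrFun (hz t) r)
    choose A hA using hex
    refine Nat.card_le_card_of_injective
      (fun y => (⟨Φ u (A y), A y, rfl⟩ : (Φ u).range)) fun y y' h => ?_
    have h' : Φ u (A y) = Φ u (A y') := congrArg Subtype.val h
    funext t
    apply Subtype.ext
    funext r
    rw [← hA y, ← hA y', h']
  have hsum : ∑ u ∈ s, (1 / Nat.card (Φ u).range : ℝ) < 1 := by
    -- At most `2 ^ ∑ d m` vectors have support `S`, which leaves the factor `2 ^ (-c)`; the `2 ^ M`
    -- possible supports are then absorbed by `M < c`.
    have hfiber : ∀ S : Finset (Fin M), ∑ u ∈ s with supp u = S, (1 / Nat.card (Φ u).range : ℝ) ≤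
        1 / 2 ^ c := by
      intro S
      have hle : ∀ u ∈ s.filter (fun u => supp u = S),
          (1 / Nat.card (Φ u).range : ℝ) ≤ 1 / 2 ^ (∑ m ∈ S, d m + c) := by
        intro u hu
        obtain ⟨hus, huS⟩ := Finset.mem_filter.1 hu
        have := hrange u hus
        rw [huS] at this
        exact one_div_le_one_div_of_le (by positivity) (by exact_mod_cast this)
      have hnum : (s.filter (fun u => supp u = S)).card ≤ 2 ^ ∑ m ∈ S, d m := by
        have hT : Fintype.card ((m : S) → Fin (d m) → ZMod 2) = 2 ^ ∑ m ∈ S, d m := by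
          rw [Fintype.card_pi, ← Finset.prod_pow_eq_pow_sum]
          simp only [Fintype.card_fun, ZMod.card, Fintype.card_fin]
          exact Finset.prod_coe_sort S fun m => 2 ^ d m
        rw [← hT, ← Finset.card_univ]
        refine Finset.card_le_card_of_injOn (fun u m => u m) (fun _ _ => Finset.mem_univ _) ?_
        intro u hu u' hu' h
        have h1 : supp u = S := (Finset.mem_filter.1 hu).2
        have h2 : supp u' = S := (Finset.mem_filter.1 hu').2
        funext m
        by_cases hm : m ∈ S
        · exact congrFun h ⟨m, hm⟩
        · have e1 : u m = 0 := by
            by_contra h0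
            exact hm (h1 ▸ Finset.mem_filter.2 ⟨Finset.mem_univ _, h0⟩)
          have e2 : u' m = 0 := by
            by_contra h0
            exact hm (h2 ▸ Finset.mem_filter.2 ⟨Finset.mem_univ _, h0⟩)
          rw [e1, e2]
      calc _ ≤ ((s.filter (fun u => supp u = S)).card : ℝ) * (1 / 2 ^ (∑ m ∈ S, d m + c)) := by
            rw [← nsmul_eq_mul]
            exact Finset.sum_le_card_nsmul _ _ _ hle
        _ ≤ (2 ^ ∑ m ∈ S, d m) * (1 / 2 ^ (∑ m ∈ S, d m + c)) := by
            gcongr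
            exact_mod_cast hnum
        _ = 1 / 2 ^ c := by
            rw [pow_add]
            field_simp
    calc ∑ u ∈ s, (1 / Nat.card (Φ u).range : ℝ)
        = ∑ S : Finset (Fin M), ∑ u ∈ s with supp u = S, (1 / Nat.card (Φ u).range : ℝ) :=
          (Finset.sum_fiberwise s supp _).symm
      _ ≤ ∑ _S : Finset (Fin M), (1 / 2 ^ c : ℝ) := Finset.sum_le_sum fun S _ => hfiber S
      _ = 2 ^ M / 2 ^ c := by simp [div_eq_mul_inv]
      _ < 1 := by
        rw [div_lt_one (by positivity)]
        exact pow_lt_pow_right₀ one_lt_two hc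
  obtain ⟨A, hA⟩ := exists_forall_apply_ne_zero s Φ hsum
  refine ⟨A, fun u hu hu' => ?_⟩
  exact Function.ne_iff.1 (hA u (Finset.mem_filter.2 ⟨Finset.mem_univ _, hu, hu'⟩))

/-- A linear encoder for the messages that all transmitters know: each receiver can decode. -/
theorem exists_joint_encoder (hM : 1 ≤ M) {ι : Type*} [Fintype ι] (l c : ℕ) (hc : K < 2 ^ c)
    (hd : 0 < Fintype.card ι → ∀ k, Fintype.card ι + c ≤ l * strength n k) :
    ∃ A : (ι → ZMod 2) →ₗ[ZMod 2] (Fin l → Fin M → Fin (levels n) → ZMod 2),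
      ∀ u, u ≠ 0 → ∀ k, ∃ t, channel n (A u t) k ≠ 0 := by
  classical
  let Ω := (ι → ZMod 2) →ₗ[ZMod 2] (Fin l → Fin M → Fin (levels n) → ZMod 2)
  have : Finite Ω := Finite.of_injective _ (DFunLike.coe_injective)
  let Φ (p : (ι → ZMod 2) × Fin K) : Ω →+ (Fin l → Fin (levels n) → ZMod 2) :=
    { toFun := fun A t => channelHom n (A p.1 t) p.2
      map_zero' := by
        funext t
        exact congrFun (map_zero (channelHom n)) p.2
      map_add' := fun A A' => by
        funext t
        exact congrFun (map_add (channelHom n) _ _) p.2 }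
  let s : Finset ((ι → ZMod 2) × Fin K) := Finset.univ.filter fun p => p.1 ≠ 0
  have hrange : ∀ p ∈ s, 2 ^ (Fintype.card ι + c) ≤ Nat.card (Φ p).range := by
    intro p hp
    have hp0 : p.1 ≠ 0 := (Finset.mem_filter.1 hp).2
    obtain ⟨j, -⟩ := Function.ne_iff.1 hp0
    refine (Nat.pow_le_pow_right two_pos (hd (Fintype.card_pos_iff.2 ⟨j⟩) p.2)).trans ?_
    have hcard : Nat.card (Fin l → outputSpace n p.2) = 2 ^ (l * strength n p.2) := by
      rw [Nat.card_fun, card_outputSpace, Nat.card_eq_fintype_card, Fintype.card_fin,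
        ← pow_mul, mul_comm]
    rw [← hcard]
    have : Finite (Φ p).range := Set.finite_range (Φ p)
    have hex : ∀ y : Fin l → outputSpace n p.2, ∃ A : Ω, ∀ t, Φ p A t = (y t).1 := by
      intro y
      choose z hz using fun t => exists_channel_eq n hM p.2 (y t).2
      obtain ⟨A, hA⟩ := exists_linearMap_apply_eq hp0 z
      refine ⟨A, fun t => ?_⟩
      change channel n (A p.1 t) p.2 = _
      rw [hA, hz]
    choose A hA using hex
    refine Nat.card_le_card_of_injective
      (fun y => (⟨Φ p (A y), A y, rfl⟩ : (Φ p).range)) fun y y' h => ?_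
    have h' : Φ p (A y) = Φ p (A y') := congrArg Subtype.val h
    funext t
    apply Subtype.ext
    rw [← hA y, ← hA y', h']
  have hsum : ∑ p ∈ s, (1 / Nat.card (Φ p).range : ℝ) < 1 := by
    have hle : ∀ p ∈ s, (1 / Nat.card (Φ p).range : ℝ) ≤ 1 / 2 ^ (Fintype.card ι + c) :=
      fun p hp => one_div_le_one_div_of_le (by positivity) (by exact_mod_cast hrange p hp)
    have hnum : s.card ≤ 2 ^ Fintype.card ι * K := by
      refine (Finset.card_le_univ s).trans_eq ?_
      simp
    calc _ ≤ (s.card : ℝ) * (1 / 2 ^ (Fintype.card ι + c)) := by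
            rw [← nsmul_eq_mul]
            exact Finset.sum_le_card_nsmul _ _ _ hle
      _ ≤ (2 ^ Fintype.card ι * K) * (1 / 2 ^ (Fintype.card ι + c)) := by
            gcongr
            exact_mod_cast hnum
      _ = K / 2 ^ c := by
            rw [pow_add]
            field_simp
      _ < 1 := by
        rw [div_lt_one (by positivity)]
        exact_mod_cast hc
  obtain ⟨A, hA⟩ := exists_forall_apply_ne_zero s Φ hsum
  refine ⟨A, fun u hu k => ?_⟩
  exact Function.ne_iff.1 (hA (u, k) (Finset.mem_filter.2 ⟨Finset.mem_univ _, hu⟩))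

end ADTMulticast

/-! ### Achievability by linear codes and choice of parameters -/

namespace ADTMulticast

variable {M K : ℕ} (n : Fin M → Fin K → ℕ)

/-- Zero-error codes for `d m` bits per block of length `l` at transmitter `m`. -/
theorem exists_code_of_bits (hM : 1 ≤ M) (d : Fin M → ℕ) (l c : ℕ) (hl : 0 < l) (hMc : M < c)
    (hKc : K < 2 ^ c)
    (hS : ∀ S : Finset (Fin M), S ⊂ Finset.univ → (∃ m ∈ S, 0 < d m) →
      ∑ m ∈ S, d m + c ≤ l * (transfer n S).rank)
    (hk : (∃ m, 0 < d m) → ∀ k, ∑ m, d m + c ≤ l * strength n k)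
    (B N : ℕ) (hN : (B + 1) * l ≤ N) (L : Fin M → ℕ) (hL : ∀ m, 0 < L m)
    (hLd : ∀ m, L m ≤ (2 ^ d m) ^ B) :
    ∃ c : FeedbackCode M K (Fin (levels n) → ZMod 2) (Fin (levels n) → ZMod 2) N L,
      ∀ k, c.errorProb (channel n) k = 0 := by
  obtain ⟨A, hA⟩ := exists_fresh_encoder n d l c hMc fun S h ⟨m, hm⟩ hd =>
    hS S h ⟨m, hm, hd m hm⟩
  obtain ⟨C, hC⟩ := exists_joint_encoder n hM (ι := (m : Fin M) × Fin (d m)) l c hKc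
    (by
      intro hpos k
      obtain ⟨⟨m, j⟩⟩ := Fintype.card_pos_iff.1 hpos
      simpa using hk ⟨m, j.pos⟩ k)
  let flat (u : (m : Fin M) → Fin (d m) → ZMod 2) (p : (m : Fin M) × Fin (d m)) : ZMod 2 :=
    u p.1 p.2
  let e (m : Fin M) (u : Fin (d m) → ZMod 2) (old : (m : Fin M) → Fin (d m) → ZMod 2) (t : ℕ) :
      Fin (levels n) → ZMod 2 :=
    if h : t < l then A m u ⟨t, h⟩ + C (flat old) ⟨t, h⟩ m else 0
  have he : ∀ m u old (t : Fin l), e m u old t = A m u t + C (flat old) t m :=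
    fun m u old t => dif_pos t.2
  refine exists_code_of_block (channel n) (U := fun m => Fin (d m) → ZMod 2) (fun m => 0) l hl e
    ?_ ?_ B N hN L hL fun m => ?_
  -- The joint part is common to both candidates and cancels by linearity; `u - u'` vanishes at `m`,
  -- so the fresh encoder separates them.
  · intro m old u u' hm hout
    by_contra hne
    obtain ⟨t, ht⟩ := hA (u - u') (sub_ne_zero.2 hne) ⟨m, sub_eq_zero.2 hm⟩
    apply ht
    have h1 := hout t t.2
    simp only [he] at h1
    have h2 : (fun m => A m ((u - u') m) t) = (fun m => A m (u m) t + C (flat old) t m) -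
        fun m => A m (u' m) t + C (flat old) t m := by
      funext m
      simp [map_sub]
    rw [h2, ← channelHom_apply, map_sub, channelHom_apply, channelHom_apply, h1, sub_self]
  -- Here the known fresh part cancels, and the joint encoder separates the old messages.
  · intro k u old old' hout
    by_contra hne
    have hflat : flat old - flat old' ≠ 0 := by
      intro h0
      apply hne
      funext m j
      exact sub_eq_zero.1 (congrFun h0 ⟨m, j⟩)
    obtain ⟨t, ht⟩ := hC _ hflat k
    apply ht
    have h1 := hout t t.2
    simp only [he] at h1
    have h2 : C (flat old - flat old') t = (fun m => A m (u m) t + C (flat old) t m) -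
        fun m => A m (u m) t + C (flat old') t m := by
      funext m
      simp [map_sub]
    rw [h2, ← channelHom_apply, map_sub, channelHom_apply, channelHom_apply, Pi.sub_apply, h1,
      sub_self]
  · simpa using hLd m

/-- Each tuple in the region is achievable after scaling down. -/
theorem achievable_smul (hM : 1 ≤ M) {R : Fin M → ℝ} (hR : ∀ m, 0 ≤ R m)
    (hS : ∀ S : Finset (Fin M), S ⊂ Finset.univ → ∑ m ∈ S, R m ≤ (transfer n S).rank)
    (hk : ∀ k, ∑ m, R m ≤ strength n k) {t : ℝ} (ht0 : 0 ≤ t) (ht1 : t < 1) :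
    Achievable (channel n) (t • R) := by
  -- The gap from `s` to `1` pays for the `c` spare bits of the union bounds; the gap from `t` to
  -- `s` pays for rounding in `d` and for incomplete or lost blocks.
  obtain ⟨s, hts, hs1⟩ := exists_between ht1
  have hs0 : 0 < s := ht0.trans_lt hts
  set c : ℕ := M + K + 1 with hc
  have hKc : K < 2 ^ c := (Nat.lt_two_pow_self).trans_le (Nat.pow_le_pow_right two_pos (by omega))
  have hlarge : ∀ a : ℝ, 0 < a → ∀ b : ℝ, ∀ᶠ l : ℕ in Filter.atTop, b ≤ l * a := fun a ha b =>
    (tendsto_natCast_atTop_atTop.atTop_mul_const ha).eventually_ge_atTop b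
  have hev : ∀ᶠ l : ℕ in Filter.atTop, ∀ m, 0 < R m → 2 ≤ (l : ℝ) * ((s - t) * R m) :=
    Filter.eventually_all.2 fun m => by
      by_cases hm : 0 < R m
      · filter_upwards [hlarge _ (mul_pos (sub_pos.2 hts) hm) 2] with l hl _ using hl
      · exact Filter.Eventually.of_forall fun l h => absurd h hm
  obtain ⟨l, ⟨hl, hlc⟩, hl0⟩ :=
    ((hev.and (hlarge _ (sub_pos.2 hs1) c)).and (Filter.eventually_gt_atTop 0)).exists
  have hl0' : (0 : ℝ) < l := by exact_mod_cast hl0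
  let d (m : Fin M) : ℕ := ⌊s * l * R m⌋₊
  have hdle : ∀ m, (d m : ℝ) ≤ s * l * R m := fun m =>
    Nat.floor_le (mul_nonneg (mul_nonneg hs0.le hl0'.le) (hR m))
  have hdpos : ∀ m, 0 < d m → 0 < R m := by
    intro m hm
    have h1 : (0 : ℝ) < d m := by exact_mod_cast hm
    exact pos_of_mul_pos_right (h1.trans_le (hdle m)) (mul_pos hs0 hl0').le
  -- A positive `d m` forces `1 ≤ r`, so the slack `l * (1 - s) * r` is at least `c`. With all rates
  -- zero, `r` may be `0` and there would be no room for `c`.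
  have hbits : ∀ (S : Finset (Fin M)) (r : ℕ), ∑ m ∈ S, R m ≤ r → (∃ m ∈ S, 0 < d m) →
      ∑ m ∈ S, d m + c ≤ l * r := by
    rintro S r hr ⟨m, hm, hdm⟩
    have hsum : 0 < ∑ m ∈ S, R m :=
      Finset.sum_pos' (fun m _ => hR m) ⟨m, hm, hdpos m hdm⟩
    have hr1 : (1 : ℝ) ≤ r := by
      have : (0 : ℝ) < r := hsum.trans_le hr
      exact_mod_cast this
    have h1 : (∑ m ∈ S, (d m : ℝ)) ≤ s * l * ∑ m ∈ S, R m := by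
      rw [Finset.mul_sum]
      exact Finset.sum_le_sum fun m _ => hdle m
    have h2 : s * l * ∑ m ∈ S, R m ≤ s * l * r :=
      mul_le_mul_of_nonneg_left hr (mul_pos hs0 hl0').le
    have h3 : (l : ℝ) * (1 - s) ≤ l * (1 - s) * r :=
      le_mul_of_one_le_right (mul_pos hl0' (sub_pos.2 hs1)).le hr1
    have h4 : (∑ m ∈ S, (d m : ℝ)) + c ≤ l * r := by linarith
    exact_mod_cast h4
  have hlt : ∀ m, 0 < R m → 0 < (d m : ℝ) / l - t * R m := by
    intro m hm
    have h1 : s * l * R m < d m + 1 := Nat.lt_floor_add_one _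
    have h2 := hl m hm
    rw [sub_pos, lt_div_iff₀ hl0']
    nlinarith
  -- The `2` covers rounding `N / l` down and the one block that carries no fresh message. A zero
  -- rate needs no bits, as it has a single message.
  have hevN : ∀ᶠ N : ℕ in Filter.atTop, ∀ m, (N : ℝ) * (t * R m) ≤ d m * ((N : ℝ) / l - 2) ∨
      R m = 0 :=
    Filter.eventually_all.2 fun m => by
      rcases (hR m).eq_or_lt' with hm | hm
      · exact Filter.Eventually.of_forall fun N => Or.inr hm
      · filter_upwards [hlarge _ (hlt m hm) (2 * d m)] with N hN
        left
        have : (N : ℝ) * ((d m : ℝ) / l - t * R m) = d m * (N / l) - N * (t * R m) := by ring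
        linarith
  have hLpos : ∀ N m, 0 < ⌈(2 : ℝ) ^ ((N : ℝ) * (t • R) m)⌉₊ := fun N m =>
    Nat.ceil_pos.2 (by positivity)
  have hcode : ∀ᶠ N : ℕ in Filter.atTop, ∃ c : FeedbackCode M K (Fin (levels n) → ZMod 2)
      (Fin (levels n) → ZMod 2) N (fun m => ⌈(2 : ℝ) ^ ((N : ℝ) * (t • R) m)⌉₊),
      ∀ k, c.errorProb (channel n) k = 0 := by
    filter_upwards [hevN, Filter.eventually_ge_atTop l] with N hN hNl
    have hq : 1 ≤ N / l := (Nat.one_le_div_iff hl0).2 hNl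
    refine exists_code_of_bits n hM d l c hl0 (by omega) hKc (fun S h => hbits S _ (hS S h))
      (fun ⟨m, hm⟩ k => hbits Finset.univ _ (hk k) ⟨m, Finset.mem_univ m, hm⟩) (N / l - 1) N
      ?_ _ (hLpos N) fun m => ?_
    · rw [Nat.sub_add_cancel hq]
      exact Nat.div_mul_le_self N l
    · rw [Nat.ceil_le, ← pow_mul]
      push_cast
      rw [← Real.rpow_natCast]
      refine Real.rpow_le_rpow_of_exponent_le one_le_two ?_
      rw [Pi.smul_apply, smul_eq_mul, Nat.cast_mul]
      rcases hN m with h | h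
      · refine h.trans (mul_le_mul_of_nonneg_left ?_ (Nat.cast_nonneg _))
        have h1 : (N : ℝ) / l < (N / l : ℕ) + 1 := by
          rw [div_lt_iff₀ hl0']
          have := Nat.lt_mul_div_succ N hl0
          rw [mul_comm] at this
          exact_mod_cast this
        rw [Nat.cast_sub hq, Nat.cast_one]
        linarith
      · rw [h, mul_zero, mul_zero]
        positivity
  refine ⟨fun m => mul_nonneg ht0 (hR m), ?_⟩
  -- A code is needed at every length; a dummy code serves the lengths without a zero-error code.
  have hall : ∀ N : ℕ, ∃ c : FeedbackCode M K (Fin (levels n) → ZMod 2)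
      (Fin (levels n) → ZMod 2) N (fun m => ⌈(2 : ℝ) ^ ((N : ℝ) * (t • R) m)⌉₊),
      (∃ c' : FeedbackCode M K (Fin (levels n) → ZMod 2) (Fin (levels n) → ZMod 2) N
        (fun m => ⌈(2 : ℝ) ^ ((N : ℝ) * (t • R) m)⌉₊),
        ∀ k, c'.errorProb (channel n) k = 0) → ∀ k, c.errorProb (channel n) k = 0 := by
    intro N
    by_cases h : ∃ c' : FeedbackCode M K (Fin (levels n) → ZMod 2) (Fin (levels n) → ZMod 2) N
        (fun m => ⌈(2 : ℝ) ^ ((N : ℝ) * (t • R) m)⌉₊), ∀ k, c'.errorProb (channel n) k = 0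
    · exact ⟨h.choose, fun _ => h.choose_spec⟩
    · exact ⟨⟨fun _ _ _ _ => 0, fun _ _ m => ⟨0, hLpos N m⟩⟩, fun h' => absurd h' h⟩
  choose code hcodes using hall
  refine ⟨code, fun k => tendsto_const_nhds.congr' ?_⟩
  filter_upwards [hcode] with N hN
  exact (hcodes N hN k).symm

end ADTMulticast

theorem theorem5 (M K : ℕ) (hM : 1 ≤ M) (hK : 1 ≤ K) (n : Fin M → Fin K → ℕ) :
    ADTMulticast.feedbackCapacityRegion (ADTMulticast.channel n) =
      {R : Fin M → ℝ |
        (∀ m, 0 ≤ R m) ∧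
        (∀ S : Finset (Fin M), S ⊂ Finset.univ →
          ∑ m ∈ S, R m ≤ ((ADTMulticast.transfer n S).rank : ℝ)) ∧
        (∀ k : Fin K,
          ∑ m, R m ≤ ((Finset.univ.sup fun m => n m k : ℕ) : ℝ))} := by
  apply Set.Subset.antisymm
  · refine closure_minimal ?_ ?_
    · intro R hR
      refine ⟨hR.1, fun S _ => ?_, fun k => ?_⟩
      · exact hR.sum_le S ⟨0, hK⟩ _ fun N L c => ADTMulticast.card_correct_le_rank n S _ N L c
      · exact hR.sum_le Finset.univ k _ fun N L c => by
          rw [Finset.compl_univ, Finset.prod_empty, one_mul]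
          exact ADTMulticast.card_correct_le_strength n k N L c
    · simp only [Set.ofPred_and, Set.ofPred_forall]
      refine .inter (isClosed_iInter fun m => ?_)
        (.inter (isClosed_iInter fun S => isClosed_iInter fun _ => ?_) (isClosed_iInter fun k => ?_))
      all_goals exact isClosed_le (by fun_prop) (by fun_prop)
  · rintro R ⟨hR, hS, hk⟩
    -- `R` is a limit of the achievable tuples `t • R` as `t` increases to `1`.
    have hlim : Filter.Tendsto (fun t : ℝ => t • R) (nhdsWithin 1 (Set.Iio 1)) (nhds R) := by
      have : Filter.Tendsto (fun t : ℝ => t • R) (nhds 1) (nhds ((1 : ℝ) • R)) :=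
        (continuous_id.smul continuous_const).tendsto 1
      rw [one_smul] at this
      exact this.mono_left nhdsWithin_le_nhds
    refine mem_closure_of_tendsto hlim ?_
    filter_upwards [Ioo_mem_nhdsLT (zero_lt_one' ℝ)] with t ht
    exact ADTMulticast.achievable_smul n hM hR hS hk ht.1.le ht.2
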